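/- Let $T>0$, and let $S\subset(0,\infty)$ be a set of parameters with $0\in\overline S$. Let $\{u^\varepsilon\}_{\varepsilon\in S}$ be a family of approximate solutions of the 2D incompressible Euler equations on $[0,T]\times\mathbb R^2$. This means that - $\operatorname{div}u^\varepsilon(\cdot,t)=0$ in the sense of distributions; - $\{u^\varepsilon\}$ is uniformly bounded in $L^\infty([0,T];L^2_{\rm loc}(\mathbb R^2))\cap \mathrm{Lip}([0,T];H^{-L}_{\rm loc}(\mathbb R^2))$ for some $L$, where $u^\varepsilon(\cdot,t)$, $t\in[0,T]$, denotes the representative that is continuous in time with values in $H^{-L}_{\rm loc}$; - for every $\Phi\in C_c^\infty([0,T)\times\mathbb R^2;\mathbb R^2)$ with $\operatorname{div}_x\Phi=0$, $$\int_0^T\!\!\int_{\mathbb R^2}\big(\Phi_t\cdot u^\varepsilon+(D\Phi\,u^\varepsilon)\cdot u^\varepsilon\big)\,dx\,dt+\int_{\mathbb R^2}\Phi(x,0)\cdot u^\varepsilon(x,0)\,dx\longrightarrow0\qquad(\varepsilon\to0,\ \varepsilon\in S).$$ For every $\varepsilon\in S$ and $t\in[0,T]$ let the distributional vorticity $\omega^\varepsilon(\cdot,t)=\partial_1u_2^\varepsilon-\partial_2u_1^\varepsilon$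 be a bounded measure. Assume that these measures are one-signed: either all of them are nonnegative or all of them are nonpositive. Assume that the initial vorticities $\omega^\varepsilon_0=\omega^\varepsilon(\cdot,0)$, $\varepsilon\in S$, are carried by a common compact set. Assume moreover that at least one of the following holds. 1. All the vorticities $\omega^\varepsilon(\cdot,t)$, $\varepsilon\in S$, $t\in[0,T]$, are carried by a common compact set. 2. The pseudo-energy and the moments $$H(\omega)=-\frac1{2\pi}\iint_{\mathbb R^2\times\mathbb R^2}\log|x-y|\,d\omega(x)\,d\omega(y),\qquad I_0(\omega)=|\omega|(\mathbb R^2),\qquad I_2(\omega)=\int_{\mathbb R^2}|x|^2\,d|\omega|(x)$$ (with $-\log 0=+\infty$) are conserved, or at least grow by a bounded amount: there is a constant $C_1$ such that $Q(\omega^\varepsilon(\cdot,t))\le Q(\omega^\varepsilon_0)+C_1$ for $Q\in\{H,I_0,I_2\}$ and all $\varepsilon\in S$, $t\in[0,T]$. For $0<R_0<\tfrac12$ and a bounded measure $\mu$ on $\mathbb R^2$ put $$\|\mu\|_{\widetilde V^{12}(\log\widetilde V)^{1/2}(\mathbb R^2)}=\Big(\sup_{\{B_j\}}\sum_j|\log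 R_j|\,\big(|\mu|(B_j)\big)^2\Big)^{1/2},$$ where the supremum is over all collections of mutually disjoint balls $B_j=B_{R_j}(x_j)\subset\mathbb R^2$ with radii $0<R_j\le R_0$. Then for every $R_0\in(0,\tfrac12)$ there is a constant $C<\infty$ such that $$\|\omega^\varepsilon(\cdot,t)\|_{\widetilde V^{12}(\log\widetilde V)^{1/2}(\mathbb R^2)}\le C\qquad\text{for all }\varepsilon\in S,\ t\in[0,T].$$ -/

import Mathlib

open MeasureTheory Set Filter Topology
open scoped NNReal ENNReal ContDiff

noncomputable section

/-- Euclidean space `ℝ^N`. -/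
abbrev RSpace (N : ℕ) := EuclideanSpace ℝ (Fin N)

/-- The divergence of a differentiable vector field. -/
def divergence {N : ℕ} (v : RSpace N → RSpace N) (x : RSpace N) : ℝ :=
  ∑ i : Fin N, (fderiv ℝ v x (EuclideanSpace.single i 1)) i

/-- `div v = 0` in the sense of distributions. -/
def WeaklyDivFree {N : ℕ} (v : RSpace N → RSpace N) : Prop :=
  ∀ φ : RSpace N → ℝ, ContDiff ℝ ∞ φ → HasCompactSupport φ →
    ∫ x, fderiv ℝ φ x (v x) = 0

/-- The Sobolev norm of `H^L(ℝ^N)`, for an integer `L ≥ 0`, of a smooth compactly supported field. -/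
def sobolevNorm {N : ℕ} (L : ℕ) (Φ : RSpace N → RSpace N) : ℝ :=
  Real.sqrt (∑ k ∈ Finset.range (L + 1), ∫ x, ‖iteratedFDeriv ℝ k Φ x‖ ^ 2)

/-- The left-hand side of the weak formulation of the Euler equations on `[0, T]` tested against
the field `Φ`: `∫₀ᵀ ∫ Φ_t · u + (DΦ u) · u dx dt + ∫ Φ(x, 0) · u(x, 0) dx`. -/
def eulerDefect {N : ℕ} (T : ℝ) (u : ℝ → RSpace N → RSpace N) (Φ : ℝ × RSpace N → RSpace N) : ℝ :=
  (∫ t in (0 : ℝ)..T, ∫ x,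
      (inner ℝ (deriv (fun s => Φ (s, x)) t) (u t x)
        + inner ℝ (fderiv ℝ (fun y => Φ (t, y)) x (u t x)) (u t x)))
    + ∫ x, inner ℝ (Φ (0, x)) (u 0 x)

/-- A family `u ε`, `ε ∈ S`, of approximate solutions of the incompressible Euler equations on
`[0, T] × ℝ^N`, as `ε ↓ 0` within the set `S` of parameters. Each `u ε` is given by the
representative which is continuous in time with values in `H^{-L}_loc`, so that `u ε t` is
meaningful for every `t ∈ [0, T]`. -/
structure IsApproximateEulerFamily {N : ℕ} (T : ℝ) (S : Set ℝ)
    (u : ℝ → ℝ → RSpace N → RSpace N) : Prop where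
  pos : S ⊆ Ioi 0
  zero_mem_closure : (0 : ℝ) ∈ closure S
  aestronglyMeasurable : ∀ ε ∈ S, AEStronglyMeasurable (fun p : ℝ × RSpace N => u ε p.1 p.2)
    ((volume.restrict (Icc 0 T)).prod volume)
  locallyIntegrable : ∀ ε ∈ S, ∀ t ∈ Icc 0 T, LocallyIntegrable (u ε t) volume
  /-- uniform bound in `L^∞([0, T]; L²_loc)` -/
  energy_bound : ∀ R : ℝ, ∃ M : ℝ≥0, ∀ ε ∈ S, ∀ᵐ t ∂(volume.restrict (Icc 0 T)),
    ∫⁻ x in Metric.closedBall 0 R, ‖u ε t x‖ₑ ^ 2 ≤ M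
  /-- uniform bound in `Lip(H^{-L}_loc)` for some `L`, with `H^{-L}` normed as the dual of `H^L` -/
  lip_bound : ∃ L : ℕ, ∀ R : ℝ, ∃ M : ℝ≥0, ∀ ε ∈ S, ∀ s ∈ Icc 0 T, ∀ t ∈ Icc 0 T,
    ∀ Φ : RSpace N → RSpace N, ContDiff ℝ ∞ Φ → HasCompactSupport Φ →
      tsupport Φ ⊆ Metric.closedBall 0 R →
      |∫ x, inner ℝ (Φ x) (u ε t x - u ε s x)| ≤ M * |t - s| * sobolevNorm L Φ
  divFree : ∀ ε ∈ S, ∀ t ∈ Icc 0 T, WeaklyDivFree (u ε t)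
  /-- consistency with the Euler equations as `ε ↓ 0` -/
  consistent : ∀ Φ : ℝ × RSpace N → RSpace N, ContDiff ℝ ∞ Φ → HasCompactSupport Φ →
    tsupport Φ ⊆ Iio T ×ˢ univ → (∀ t x, divergence (fun y => Φ (t, y)) x = 0) →
    Tendsto (fun ε => eulerDefect T (u ε) Φ) (𝓝[S] 0) (𝓝 0)

/-- The integral of a function against a signed measure, `∫ φ dσ = ∫ φ dσ⁺ - ∫ φ dσ⁻`. -/
def signedIntegral {N : ℕ} (σ : SignedMeasure (RSpace N)) (φ : RSpace N → ℝ) : ℝ :=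
  (∫ x, φ x ∂σ.toJordanDecomposition.posPart) - ∫ x, φ x ∂σ.toJordanDecomposition.negPart

/-- The bounded measure `σ` is the vorticity `∂₁v₂ - ∂₂v₁` of the planar field `v`, in the sense
of distributions. -/
def IsVorticity (v : RSpace 2 → RSpace 2) (σ : SignedMeasure (RSpace 2)) : Prop :=
  ∀ φ : RSpace 2 → ℝ, ContDiff ℝ ∞ φ → HasCompactSupport φ →
    signedIntegral σ φ =
      ∫ x, (v x 0 * fderiv ℝ φ x (EuclideanSpace.single 1 1)
        - v x 1 * fderiv ℝ φ x (EuclideanSpace.single 0 1))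

/-- `σ` is carried by the closed ball of radius `R` about the origin. -/
def SupportedInBall (R : ℝ) (σ : SignedMeasure (RSpace 2)) : Prop :=
  σ.totalVariation (Metric.closedBall 0 R)ᶜ = 0

/-- Collections of mutually disjoint balls contained in `Ω`, of radii at most `R₀`. A ball is given
by its centre and its radius. -/
def IsBallPacking (Ω : Set (RSpace 2)) (R₀ : ℝ) (𝓑 : Set (RSpace 2 × ℝ)) : Prop :=
  (∀ b ∈ 𝓑, 0 < b.2 ∧ b.2 ≤ R₀ ∧ Metric.ball b.1 b.2 ⊆ Ω) ∧
    𝓑.PairwiseDisjoint fun b => Metric.ball b.1 b.2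

/-- The norm of the space `Ṽ^{12}(log Ṽ)^{1/2}(Ω)`, `Ω ⊆ ℝ²`, of measures: the square root of the
supremum of `∑_j |log R_j| (|μ|(B_j))²` over the packings of `Ω` by balls `B_j` of radii
`R_j ≤ R₀`. -/
def logVNorm (Ω : Set (RSpace 2)) (R₀ : ℝ) (μ : SignedMeasure (RSpace 2)) : ℝ≥0∞ :=
  (⨆ (𝓑 : Set (RSpace 2 × ℝ)) (_ : IsBallPacking Ω R₀ 𝓑),
    ∑' b : 𝓑, ENNReal.ofReal |Real.log b.1.2| *
      μ.totalVariation (Metric.ball b.1.1 b.1.2) ^ 2) ^ (1 / 2 : ℝ)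

/-- The pseudo-energy `-(1/2π) ∬ log|x - y| dμ(x) dμ(y)` of a nonnegative measure, with
`-log 0 = +∞`. The positive and the negative part of the kernel are integrated separately; the
second integral is finite as soon as `μ` has finite mass and finite second moment. -/
def pseudoEnergy (μ : Measure (RSpace 2)) : EReal :=
  ((1 / (2 * Real.pi) : ℝ) : EReal) *
    (((∫⁻ x, ∫⁻ y, (-ENNReal.log (edist x y)).toENNReal ∂μ ∂μ : ℝ≥0∞) : EReal)
      - ((∫⁻ x, ∫⁻ y, (ENNReal.log (edist x y)).toENNReal ∂μ ∂μ : ℝ≥0∞) : EReal))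

/-- The moment `I₂ = ∫ |x|² dμ(x)`. -/
def secondMoment (μ : Measure (RSpace 2)) : ℝ≥0∞ := ∫⁻ x, ‖x‖ₑ ^ 2 ∂μ

/-- The total mass `I₀` and the second moment `I₂` of `ν`, as well as its pseudo-energy, exceed
those of `μ` by at most `C`. -/
def InvariantsControlledBy (C : ℝ≥0) (μ ν : Measure (RSpace 2)) : Prop :=
  ν univ ≤ μ univ + C ∧ secondMoment ν ≤ secondMoment μ + C ∧
    pseudoEnergy ν ≤ pseudoEnergy μ + ((C : ℝ) : EReal)

end

/-! One-signed vorticity with locally bounded velocity energy has bounded logarithmic self-energy,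
and this energy dominates the packing norm. Let `μ` be the total variation of a vorticity carried by
a fixed ball. Integration by parts moves a test function `φ` onto the velocity, so `∫ φ dμ` is at
most a constant times the Dirichlet norm of `φ`. The velocity is bounded in local `L²` only for
almost every time; Lipschitz continuity in `H^{-L}` carries the dual form of the bound to all times.
For `φ`, take the potential of `μ` for a smooth dyadic truncation of `-log|x|`. Its squared
Dirichlet norm is at most `K (2 μ(ℝ²)² + X)` with `X = ∫ φ dμ`; duality then gives a quadratic
inequality that bounds `X` independently of the truncation
(`exists_measure_univ_le_and_logEnergy_le`). The limit bounds the energy of `log⁻|x - y|`. Two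
points of a ball of radius `r` are less than `2r` apart, so `|log 2r| μ(B)²` is at most the share of
the energy that falls on `B`, and disjoint balls have disjoint shares (`logVNorm_le`). If only the
initial supports are controlled, the energy is bounded at time zero, and the bounds on `H`, `I₀`,
`I₂` propagate it: the part of `H` from distant pairs is controlled by the moments
(`logEnergy_le_of_pseudoEnergy_le`). -/

noncomputable section

/-! ### The dyadic logarithmic kernel and its potential -/

/-- A smooth bump equal to `1` on the unit ball and supported in the ball of radius `2`. -/
def unitBump : ContDiffBump (0 : RSpace 2) := ⟨1, 2, one_pos, one_lt_two⟩

/-- The sum of `n` dyadic dilates of `unitBump`, a smooth surrogate of the logarithmic kernel. -/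
def dyadicKernel (n : ℕ) (x : RSpace 2) : ℝ :=
  ∑ k ∈ Finset.range n, unitBump ((2 : ℝ) ^ k • x)

/-- The potential of `μ` with respect to `dyadicKernel n`. -/
def dyadicPotential (μ : Measure (RSpace 2)) (n : ℕ) (x : RSpace 2) : ℝ :=
  ∫ y, dyadicKernel n (x - y) ∂μ

lemma contDiff_dyadicKernel (n : ℕ) : ContDiff ℝ ∞ (dyadicKernel n) := by
  unfold dyadicKernel
  refine ContDiff.sum fun k _ => ?_
  exact unitBump.contDiff.comp (contDiff_id.const_smul _)

lemma dyadicKernel_nonneg (n : ℕ) (x : RSpace 2) : 0 ≤ dyadicKernel n x :=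
  Finset.sum_nonneg fun _ _ => unitBump.nonneg

lemma dyadicKernel_le (n : ℕ) (x : RSpace 2) : dyadicKernel n x ≤ n := by
  refine (Finset.sum_le_card_nsmul _ _ 1 fun _ _ => unitBump.le_one).trans ?_
  simp

lemma unitBump_eq_zero {x : RSpace 2} (hx : 2 ≤ ‖x‖) : unitBump x = 0 :=
  unitBump.zero_of_le_dist (by rw [dist_zero_right]; exact hx)

lemma dyadicKernel_eq_zero (n : ℕ) {x : RSpace 2} (hx : 2 ≤ ‖x‖) : dyadicKernel n x = 0 := by
  refine Finset.sum_eq_zero fun k _ => unitBump_eq_zero ?_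
  rw [norm_smul, norm_pow, Real.norm_ofNat]
  nlinarith [one_le_pow₀ (M₀ := ℝ) one_le_two (n := k)]

lemma hasCompactSupport_dyadicKernel (n : ℕ) : HasCompactSupport (dyadicKernel n) := by
  refine HasCompactSupport.intro (isCompact_closedBall (0 : RSpace 2) 2) fun x hx => ?_
  refine dyadicKernel_eq_zero n ?_
  simpa using le_of_lt (not_le.1 fun h => hx (by simpa using h))

/-- Scaling: the `k`-th dilate has slope of order `2 ^ k` and lives at distance at most `2 · 2⁻ᵏ`.
The constant does not depend on `n`. -/
lemma exists_fderiv_dyadicKernel_le : ∃ D : ℝ≥0, ∀ n x,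
    ‖fderiv ℝ (dyadicKernel n) x‖ ≤ ∑ k ∈ Finset.range n,
      (Metric.closedBall (0 : RSpace 2) (2 * (2⁻¹ : ℝ) ^ k)).indicator
        (fun _ => (D : ℝ) * 2 ^ k) x := by
  have hb : ContDiff ℝ ∞ unitBump := unitBump.contDiff
  obtain ⟨D, hD⟩ := (unitBump.hasCompactSupport.fderiv ℝ).exists_bound_of_continuous
    (hb.continuous_fderiv (by simp))
  refine ⟨D.toNNReal, fun n x => ?_⟩
  have hsum : fderiv ℝ (dyadicKernel n) x
      = ∑ k ∈ Finset.range n, fderiv ℝ (fun x => unitBump ((2 : ℝ) ^ k • x)) x := by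
    unfold dyadicKernel
    refine fderiv_fun_sum fun k _ => ?_
    exact ((hb.comp (contDiff_id.const_smul ((2 : ℝ) ^ k))).differentiable (by simp)) x
  rw [hsum]
  refine (norm_sum_le _ _).trans (Finset.sum_le_sum fun k _ => ?_)
  rw [fderiv_comp_smul, norm_smul, norm_pow, Real.norm_ofNat]
  by_cases hx : x ∈ Metric.closedBall (0 : RSpace 2) (2 * (2⁻¹ : ℝ) ^ k)
  · rw [indicator_of_mem hx, mul_comm]
    gcongr
    exact (hD _).trans (Real.le_coe_toNNReal D)
  · rw [indicator_of_notMem hx]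
    have : fderiv ℝ unitBump ((2 : ℝ) ^ k • x) = 0 := by
      by_contra h
      have h1 := support_fderiv_subset ℝ (f := unitBump) (Function.mem_support.2 h)
      rw [unitBump.tsupport_eq] at h1
      apply hx
      rw [mem_closedBall_zero_iff, norm_smul, norm_pow, Real.norm_ofNat] at h1
      rw [mem_closedBall_zero_iff, inv_pow, ← div_eq_mul_inv, le_div_iff₀ (by positivity), mul_comm]
      exact h1
    simp [this]

lemma integrable_dyadicKernel (μ : Measure (RSpace 2)) [IsFiniteMeasure μ] (n : ℕ) (x : RSpace 2) :
    Integrable (fun y => dyadicKernel n (x - y)) μ := by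
  refine Integrable.of_bound (C := n) ?_ (Eventually.of_forall fun y => ?_)
  · exact ((contDiff_dyadicKernel n).continuous.comp
      (continuous_const.sub continuous_id)).aestronglyMeasurable
  · rw [Real.norm_of_nonneg (dyadicKernel_nonneg _ _)]
    exact dyadicKernel_le _ _

lemma dyadicPotential_nonneg (μ : Measure (RSpace 2)) (n : ℕ) (x : RSpace 2) :
    0 ≤ dyadicPotential μ n x :=
  integral_nonneg fun _ => dyadicKernel_nonneg _ _

lemma dyadicPotential_le (μ : Measure (RSpace 2)) [IsFiniteMeasure μ] (n : ℕ) (x : RSpace 2) :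
    dyadicPotential μ n x ≤ n * μ.real univ := by
  refine (integral_mono (integrable_dyadicKernel μ n x) (integrable_const (n : ℝ))
    fun y => dyadicKernel_le _ _).trans ?_
  simp [mul_comm]

lemma contDiff_dyadicPotential (μ : Measure (RSpace 2)) [IsFiniteMeasure μ] (n : ℕ) :
    ContDiff ℝ ∞ (dyadicPotential μ n) := by
  -- The potential is the convolution of the constant `1` with the kernel, taken with respect to `μ`
  -- in place of Lebesgue measure.
  have h := (hasCompactSupport_dyadicKernel n).contDiff_convolution_right
    (ContinuousLinearMap.lsmul ℝ ℝ) (μ := μ) (n := ⊤)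
    (locallyIntegrable_const (1 : ℝ)) (contDiff_dyadicKernel n)
  convert h using 1
  ext x
  simp [dyadicPotential, convolution]

lemma tsupport_dyadicPotential_subset {μ : Measure (RSpace 2)} {R : ℝ}
    (hμ : μ (Metric.closedBall 0 R)ᶜ = 0) (n : ℕ) :
    tsupport (dyadicPotential μ n) ⊆ Metric.closedBall 0 (R + 2) := by
  refine closure_minimal (fun x hx => ?_) Metric.isClosed_closedBall
  by_contra hxR
  apply hx
  refine integral_eq_zero_of_ae ?_
  have : ∀ᵐ y ∂μ, y ∈ Metric.closedBall (0 : RSpace 2) R := by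
    rw [ae_iff]; exact hμ
  filter_upwards [this] with y hy
  refine dyadicKernel_eq_zero n ?_
  rw [mem_closedBall_zero_iff] at hy hxR
  linarith [norm_le_norm_sub_add x y]

lemma exists_fderiv_dyadicPotential_le : ∃ D : ℝ≥0, ∀ (μ : Measure (RSpace 2)) [IsFiniteMeasure μ]
    (n : ℕ) (x : RSpace 2), ‖fderiv ℝ (dyadicPotential μ n) x‖ₑ ≤
      ∑ k ∈ Finset.range n, (D : ℝ≥0∞) * 2 ^ k * μ (Metric.closedBall x (2 * (2⁻¹ : ℝ) ^ k)) := by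
  obtain ⟨D, hD⟩ := exists_fderiv_dyadicKernel_le
  refine ⟨D, fun μ _ n x => ?_⟩
  have hc : Continuous (fderiv ℝ (dyadicKernel n)) :=
    (contDiff_dyadicKernel n).continuous_fderiv (by simp)
  have hder : HasFDerivAt (dyadicPotential μ n)
      (∫ y, fderiv ℝ (dyadicKernel n) (x - y) ∂μ) x := by
    refine hasFDerivAt_integral_of_dominated_of_fderiv_le (s := univ)
      (F' := fun x y => fderiv ℝ (dyadicKernel n) (x - y))
      (bound := fun _ => ∑ k ∈ Finset.range n, (D : ℝ) * 2 ^ k) univ_mem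
      (Eventually.of_forall fun z => (integrable_dyadicKernel μ n z).aestronglyMeasurable)
      (integrable_dyadicKernel μ n x) ?_ ?_ (integrable_const _) ?_
    · exact (hc.comp (continuous_const.sub continuous_id)).aestronglyMeasurable
    · refine Eventually.of_forall fun y z _ => (hD n _).trans (Finset.sum_le_sum fun k _ => ?_)
      exact indicator_le_self' (fun _ _ => by positivity) _
    · refine Eventually.of_forall fun y z _ => ?_
      have := (((contDiff_dyadicKernel n).differentiable (by simp)) (z - y)).hasFDerivAt
      simpa [Function.comp_def] using this.comp z ((hasFDerivAt_id z).sub_const y)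
  rw [hder.fderiv]
  refine (enorm_integral_le_lintegral_enorm _).trans ?_
  calc ∫⁻ y, ‖fderiv ℝ (dyadicKernel n) (x - y)‖ₑ ∂μ
      ≤ ∫⁻ y, ∑ k ∈ Finset.range n, (Metric.closedBall x (2 * (2⁻¹ : ℝ) ^ k)).indicator
          (fun _ => (D : ℝ≥0∞) * 2 ^ k) y ∂μ := by
        refine lintegral_mono fun y => ?_
        rw [← ofReal_norm]
        refine (ENNReal.ofReal_le_ofReal (hD n _)).trans ?_
        rw [ENNReal.ofReal_sum_of_nonneg
          fun k _ => indicator_nonneg (fun _ _ => by positivity) _]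
        refine Finset.sum_le_sum fun k _ => ?_
        by_cases h : y ∈ Metric.closedBall x (2 * (2⁻¹ : ℝ) ^ k)
        · rw [indicator_of_mem h]
          refine (ENNReal.ofReal_le_ofReal
            (indicator_le_self' (fun _ _ => by positivity) _)).trans ?_
          rw [ENNReal.ofReal_mul D.coe_nonneg, ENNReal.ofReal_coe_nnreal,
            ENNReal.ofReal_pow zero_le_two, ENNReal.ofReal_ofNat]
        · rw [indicator_of_notMem h, indicator_of_notMem, ENNReal.ofReal_zero]
          rwa [mem_closedBall_zero_iff, ← dist_eq_norm, dist_comm]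
    _ = _ := by
        rw [lintegral_finsetSum _ fun k _ =>
          measurable_const.indicator Metric.isClosed_closedBall.measurableSet]
        refine Finset.sum_congr rfl fun k _ => ?_
        rw [lintegral_indicator_const Metric.isClosed_closedBall.measurableSet]

/-! ### Dirichlet energy of the potential in terms of close pairs -/

/-- The mass of the pairs of points at distance at most `r`. -/
def pairMass (μ : Measure (RSpace 2)) (r : ℝ) : ℝ≥0∞ :=
  ∫⁻ y, μ (Metric.closedBall y r) ∂μ

lemma measurable_measure_closedBall (μ : Measure (RSpace 2)) [IsFiniteMeasure μ] (r : ℝ) :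
    Measurable fun x => μ (Metric.closedBall x r) := by
  have hs : MeasurableSet {p : RSpace 2 × RSpace 2 | dist p.2 p.1 ≤ r} :=
    (isClosed_le (continuous_snd.dist continuous_fst) continuous_const).measurableSet
  exact measurable_measure_prodMk_left hs

lemma pairMass_le (μ : Measure (RSpace 2)) (r : ℝ) : pairMass μ r ≤ μ univ ^ 2 := by
  refine (lintegral_mono fun y => measure_mono (subset_univ _)).trans ?_
  rw [lintegral_const, sq]

/-- Expand the smaller ball as an integral over its points `y` and apply Tonelli. Since `|x - y| ≤ r
≤ s`, the larger ball lies in the ball of radius `2s` about `y`, and the `x`-integral leaves only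
the volume of a ball of radius `r`. -/
lemma lintegral_measure_closedBall_mul_le (μ : Measure (RSpace 2)) [IsFiniteMeasure μ] {r s : ℝ}
    (hrs : r ≤ s) :
    ∫⁻ x, μ (Metric.closedBall x r) * μ (Metric.closedBall x s) ≤
      volume (Metric.closedBall (0 : RSpace 2) r) * pairMass μ (2 * s) := by
  have hs : MeasurableSet {p : RSpace 2 × RSpace 2 | dist p.2 p.1 ≤ r} :=
    (isClosed_le (continuous_snd.dist continuous_fst) continuous_const).measurableSet
  calc ∫⁻ x, μ (Metric.closedBall x r) * μ (Metric.closedBall x s)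
      = ∫⁻ x, ∫⁻ y, {p : RSpace 2 × RSpace 2 | dist p.2 p.1 ≤ r}.indicator
          (fun p => μ (Metric.closedBall p.1 s)) (x, y) ∂μ := by
        refine lintegral_congr fun x => ?_
        rw [mul_comm, ← lintegral_indicator_const Metric.isClosed_closedBall.measurableSet]
        rfl
    _ = ∫⁻ y, (∫⁻ x, {p : RSpace 2 × RSpace 2 | dist p.2 p.1 ≤ r}.indicator
          (fun p => μ (Metric.closedBall p.1 s)) (x, y)) ∂μ := by
        refine lintegral_lintegral_swap ?_
        exact (((measurable_measure_closedBall μ s).comp measurable_fst).indicator hs).aemeasurable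
    _ ≤ ∫⁻ y, (∫⁻ x, (Metric.closedBall y r).indicator
          (fun _ => μ (Metric.closedBall y (2 * s))) x) ∂μ := by
        refine lintegral_mono fun y => lintegral_mono fun x => ?_
        by_cases h : dist y x ≤ r
        · rw [indicator_of_mem (by exact h), indicator_of_mem (by rwa [Metric.mem_closedBall'])]
          refine measure_mono (Metric.closedBall_subset_closedBall' ?_)
          rw [dist_comm] at h
          linarith
        · rw [indicator_of_notMem (by exact h)]
          exact zero_le
    _ = ∫⁻ y, volume (Metric.closedBall (0 : RSpace 2) r) * μ (Metric.closedBall y (2 * s)) ∂μ := by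
        refine lintegral_congr fun y => ?_
        rw [lintegral_indicator_const Metric.isClosed_closedBall.measurableSet,
          Measure.addHaar_closedBall_center volume y r, mul_comm]
    _ = _ := lintegral_const_mul _ (measurable_measure_closedBall μ _)

/-- Truncated subtraction kills one of the two exponents, so the weight is `2^{-|k - j|}`; each side
of `j` contributes at most `2`. -/
lemma sum_geometric_abs_sub_le (j n : ℕ) :
    ∑ k ∈ Finset.range n, (2⁻¹ : ℝ≥0∞) ^ (k - j) * 2⁻¹ ^ (j - k) ≤ 4 := by
  have hgeo : ∑' k : ℕ, (2⁻¹ : ℝ≥0∞) ^ k = 2 := by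
    rw [ENNReal.tsum_geometric, ENNReal.one_sub_inv_two, inv_inv]
  refine (ENNReal.sum_le_tsum _).trans ?_
  rw [← ENNReal.summable.sum_add_tsum_nat_add' (k := j), show (4 : ℝ≥0∞) = 2 + 2 by norm_num]
  refine add_le_add ?_ ?_
  -- The exponent is lowered from `j - k` to `j - 1 - k` so that the sum is an exact reflection of
  -- `range j`.
  · calc ∑ k ∈ Finset.range j, (2⁻¹ : ℝ≥0∞) ^ (k - j) * 2⁻¹ ^ (j - k)
        ≤ ∑ k ∈ Finset.range j, (2⁻¹ : ℝ≥0∞) ^ (j - 1 - k) := by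
          refine Finset.sum_le_sum fun k hk => ?_
          rw [Finset.mem_range] at hk
          rw [Nat.sub_eq_zero_of_le hk.le, pow_zero, one_mul]
          exact pow_le_pow_right_of_le_one' (by simp) (by omega)
      _ = ∑ k ∈ Finset.range j, (2⁻¹ : ℝ≥0∞) ^ k :=
          Finset.sum_range_reflect (fun i => (2⁻¹ : ℝ≥0∞) ^ i) j
      _ ≤ 2 := (ENNReal.sum_le_tsum _).trans hgeo.le
  · refine le_of_eq ?_
    rw [← hgeo]
    refine tsum_congr fun k => ?_
    simp

/-- The factor `4` shifts the scale by two indices; the two largest radii, `4` and `2`, are paid for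
by the squared mass. -/
lemma sum_pairMass_four_mul_le (μ : Measure (RSpace 2)) (n : ℕ) :
    ∑ j ∈ Finset.range n, pairMass μ (4 * (2⁻¹ : ℝ) ^ j) ≤
      2 * μ univ ^ 2 + ∑ j ∈ Finset.range n, pairMass μ ((2⁻¹ : ℝ) ^ j) := by
  calc ∑ j ∈ Finset.range n, pairMass μ (4 * (2⁻¹ : ℝ) ^ j)
      ≤ ∑ j ∈ Finset.range (n + 2), pairMass μ (4 * (2⁻¹ : ℝ) ^ j) :=
        Finset.sum_le_sum_of_subset (Finset.range_mono (by omega))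
    _ = (∑ j ∈ Finset.range n, pairMass μ ((2⁻¹ : ℝ) ^ j)
          + pairMass μ (4 * (2⁻¹ : ℝ) ^ (0 + 1))) + pairMass μ (4 * (2⁻¹ : ℝ) ^ 0) := by
        rw [Finset.sum_range_succ', Finset.sum_range_succ']
        have : ∀ j : ℕ, 4 * (2⁻¹ : ℝ) ^ (j + 1 + 1) = 2⁻¹ ^ j := fun j => by ring
        simp only [this]
    _ ≤ (∑ j ∈ Finset.range n, pairMass μ ((2⁻¹ : ℝ) ^ j) + μ univ ^ 2) + μ univ ^ 2 := by
        gcongr <;> exact pairMass_le _ _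
    _ = _ := by ring

/-- In the plane the smaller ball has volume of order `4⁻ᵏ`, which turns the slopes `2 ^ j * 2 ^ k`
into the decay `2^{-(k - j)}` between different scales. -/
lemma two_pow_mul_lintegral_le (μ : Measure (RSpace 2)) [IsFiniteMeasure μ] {j k : ℕ}
    (hjk : j ≤ k) :
    (2 : ℝ≥0∞) ^ j * 2 ^ k * ∫⁻ x, μ (Metric.closedBall x (2 * (2⁻¹ : ℝ) ^ k)) *
        μ (Metric.closedBall x (2 * (2⁻¹ : ℝ) ^ j)) ≤
      4 * volume (Metric.ball (0 : RSpace 2) 1) *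
        (2⁻¹ ^ (k - j) * pairMass μ (4 * (2⁻¹ : ℝ) ^ j)) := by
  have hle : 2 * (2⁻¹ : ℝ) ^ k ≤ 2 * (2⁻¹ : ℝ) ^ j :=
    mul_le_mul_of_nonneg_left (pow_le_pow_of_le_one (by norm_num) (by norm_num) hjk) zero_le_two
  have hvol : volume (Metric.closedBall (0 : RSpace 2) (2 * (2⁻¹ : ℝ) ^ k))
      = 4 * (2⁻¹ ^ k) ^ 2 * volume (Metric.ball (0 : RSpace 2) 1) := by
    rw [Measure.addHaar_closedBall _ _ (by positivity), finrank_euclideanSpace_fin, mul_pow,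
      ENNReal.ofReal_mul (by norm_num), ENNReal.ofReal_pow (by positivity),
      ENNReal.ofReal_pow (by positivity), ENNReal.ofReal_pow (by positivity),
      ENNReal.ofReal_inv_of_pos two_pos, ENNReal.ofReal_ofNat]
    norm_num
  have hpow : (2 : ℝ≥0∞) ^ j * 2 ^ k * (2⁻¹ ^ k) ^ 2 = 2⁻¹ ^ (k - j) := by
    obtain ⟨i, rfl⟩ := Nat.exists_eq_add_of_le hjk
    have hinv : ∀ m : ℕ, (2 : ℝ≥0∞) ^ m * 2⁻¹ ^ m = 1 := fun m => by
      rw [← mul_pow, ENNReal.mul_inv_cancel two_ne_zero ENNReal.ofNat_ne_top, one_pow]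
    calc (2 : ℝ≥0∞) ^ j * 2 ^ (j + i) * (2⁻¹ ^ (j + i)) ^ 2
        = (2 ^ j * 2⁻¹ ^ j) * (2 ^ (j + i) * 2⁻¹ ^ (j + i)) * 2⁻¹ ^ i := by
          rw [pow_add 2⁻¹ j i]; ring
      _ = 2⁻¹ ^ (j + i - j) := by rw [hinv, hinv, Nat.add_sub_cancel_left]; simp
  calc (2 : ℝ≥0∞) ^ j * 2 ^ k * ∫⁻ x, μ (Metric.closedBall x (2 * (2⁻¹ : ℝ) ^ k)) *
        μ (Metric.closedBall x (2 * (2⁻¹ : ℝ) ^ j))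
      ≤ 2 ^ j * 2 ^ k * (4 * (2⁻¹ ^ k) ^ 2 * volume (Metric.ball (0 : RSpace 2) 1) *
          pairMass μ (2 * (2 * (2⁻¹ : ℝ) ^ j))) := by
        gcongr
        exact (lintegral_measure_closedBall_mul_le μ hle).trans_eq (by rw [hvol])
    _ = 4 * volume (Metric.ball (0 : RSpace 2) 1) * ((2 ^ j * 2 ^ k * (2⁻¹ ^ k) ^ 2) *
          pairMass μ (4 * (2⁻¹ : ℝ) ^ j)) := by
        rw [show 2 * (2 * (2⁻¹ : ℝ) ^ j) = 4 * (2⁻¹ : ℝ) ^ j by ring]; ring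
    _ = _ := by rw [hpow]

/-- Almost orthogonality of scales: after expanding the square, the geometric off-diagonal decay
makes the double sum comparable to a single sum, as in Schur's test. -/
lemma lintegral_sq_sum_measure_closedBall_le (μ : Measure (RSpace 2)) [IsFiniteMeasure μ] (n : ℕ) :
    ∫⁻ x, (∑ k ∈ Finset.range n, 2 ^ k * μ (Metric.closedBall x (2 * (2⁻¹ : ℝ) ^ k))) ^ 2 ≤
      32 * volume (Metric.ball (0 : RSpace 2) 1) *
        (2 * μ univ ^ 2 + ∑ j ∈ Finset.range n, pairMass μ ((2⁻¹ : ℝ) ^ j)) := by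
  set V := volume (Metric.ball (0 : RSpace 2) 1)
  set m : ℕ → RSpace 2 → ℝ≥0∞ := fun k x => μ (Metric.closedBall x (2 * (2⁻¹ : ℝ) ^ k))
  set β : ℕ → ℝ≥0∞ := fun j => pairMass μ (4 * (2⁻¹ : ℝ) ^ j)
  set w : ℕ → ℕ → ℝ≥0∞ := fun j k => 2⁻¹ ^ (k - j) * 2⁻¹ ^ (j - k) with hw
  have hmm : ∀ k, Measurable (m k) := fun k => measurable_measure_closedBall μ _
  have hpair : ∀ j k, (2 : ℝ≥0∞) ^ j * 2 ^ k * ∫⁻ x, m j x * m k x ≤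
      4 * V * (w j k * (β j + β k)) := by
    intro j k
    rcases le_total j k with h | h
    · have := two_pow_mul_lintegral_le μ h
      simp_rw [mul_comm (m j _)]
      refine this.trans ?_
      simp only [hw, Nat.sub_eq_zero_of_le h, pow_zero, mul_one]
      gcongr
      exact le_self_add
    · have := two_pow_mul_lintegral_le μ h
      rw [mul_comm (2 ^ j : ℝ≥0∞)]
      refine this.trans ?_
      simp only [hw, Nat.sub_eq_zero_of_le h, pow_zero, one_mul]
      gcongr
      exact le_add_self
  have hswap : ∑ j ∈ Finset.range n, ∑ k ∈ Finset.range n, w j k * (β j + β k) ≤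
      8 * ∑ j ∈ Finset.range n, β j := by
    have h1 : ∑ j ∈ Finset.range n, ∑ k ∈ Finset.range n, w j k * β j ≤
        4 * ∑ j ∈ Finset.range n, β j := by
      rw [Finset.mul_sum]
      refine Finset.sum_le_sum fun j _ => ?_
      rw [← Finset.sum_mul]
      gcongr
      exact sum_geometric_abs_sub_le j n
    have h2 : ∑ j ∈ Finset.range n, ∑ k ∈ Finset.range n, w j k * β k ≤
        4 * ∑ j ∈ Finset.range n, β j := by
      rw [Finset.sum_comm]
      refine le_of_eq_of_le ?_ h1
      refine Finset.sum_congr rfl fun j _ => Finset.sum_congr rfl fun k _ => ?_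
      simp only [hw]
      rw [mul_comm (2⁻¹ ^ (j - k) : ℝ≥0∞)]
    simp only [mul_add, Finset.sum_add_distrib]
    refine (add_le_add h1 h2).trans_eq ?_
    rw [← add_mul]; norm_num
  calc ∫⁻ x, (∑ k ∈ Finset.range n, 2 ^ k * m k x) ^ 2
      = ∫⁻ x, ∑ j ∈ Finset.range n, ∑ k ∈ Finset.range n, 2 ^ j * 2 ^ k * (m j x * m k x) := by
        refine lintegral_congr fun x => ?_
        rw [sq, Finset.sum_mul_sum]
        refine Finset.sum_congr rfl fun j _ => Finset.sum_congr rfl fun k _ => ?_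
        ring
    _ = ∑ j ∈ Finset.range n, ∑ k ∈ Finset.range n, 2 ^ j * 2 ^ k * ∫⁻ x, m j x * m k x := by
        have hjk : ∀ j k, Measurable fun x => (2 : ℝ≥0∞) ^ j * 2 ^ k * (m j x * m k x) :=
          fun j k => ((hmm j).mul (hmm k)).const_mul _
        rw [lintegral_finsetSum _ fun j _ => Finset.measurable_fun_sum _ fun k _ => hjk j k]
        refine Finset.sum_congr rfl fun j _ => ?_
        rw [lintegral_finsetSum _ fun k _ => hjk j k]
        refine Finset.sum_congr rfl fun k _ => ?_
        exact lintegral_const_mul _ ((hmm j).mul (hmm k))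
    _ ≤ ∑ j ∈ Finset.range n, ∑ k ∈ Finset.range n, 4 * V * (w j k * (β j + β k)) :=
        Finset.sum_le_sum fun j _ => Finset.sum_le_sum fun k _ => hpair j k
    _ = 4 * V * ∑ j ∈ Finset.range n, ∑ k ∈ Finset.range n, w j k * (β j + β k) := by
        simp only [Finset.mul_sum]
    _ ≤ 4 * V * (8 * (2 * μ univ ^ 2 + ∑ j ∈ Finset.range n, pairMass μ ((2⁻¹ : ℝ) ^ j))) := by
        gcongr
        refine hswap.trans ?_
        gcongr
        exact sum_pairMass_four_mul_le μ n
    _ = _ := by ring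

/-! ### Logarithmic energy and the duality bound -/

/-- The integral of the positive part of `-log|x - y|` against `μ ⊗ μ`. -/
def logEnergy (μ : Measure (RSpace 2)) : ℝ≥0∞ :=
  ∫⁻ x, ∫⁻ y, (-ENNReal.log (edist x y)).toENNReal ∂μ ∂μ

/-- If `2⁻⁽ⁿ⁺¹⁾ < |x - y| ≤ 2⁻ⁿ`, then `-log|x - y|` is below `(n + 1) log 2`, and `y` lies in the
first `n + 1` balls. On the diagonal both sides are infinite. -/
lemma toENNReal_neg_log_edist_le (x y : RSpace 2) :
    (-ENNReal.log (edist x y)).toENNReal ≤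
      ∑' k : ℕ, (Metric.closedBall x ((2⁻¹ : ℝ) ^ k)).indicator
        (fun _ => ENNReal.ofReal (Real.log 2)) y := by
  have hlog2 : 0 < Real.log 2 := Real.log_pos one_lt_two
  rcases eq_or_lt_of_le (dist_nonneg (x := x) (y := y)) with h | h
  · have hxy : x = y := dist_eq_zero.1 h.symm
    subst hxy
    refine le_top.trans_eq (Eq.symm ?_)
    have : ∀ k : ℕ, (Metric.closedBall x ((2⁻¹ : ℝ) ^ k)).indicator
        (fun _ => ENNReal.ofReal (Real.log 2)) x = ENNReal.ofReal (Real.log 2) := fun k =>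
      indicator_of_mem (Metric.mem_closedBall_self (by positivity)) _
    simp_rw [this]
    exact ENNReal.tsum_const_eq_top_of_ne_zero (by simpa using hlog2)
  · rw [edist_dist, ENNReal.log_ofReal_of_pos h, ← EReal.coe_neg, EReal.toENNReal_of_ne_top
      (EReal.coe_ne_top _), EReal.toReal_coe]
    rcases le_or_gt 1 (dist x y) with h1 | h1
    · rw [ENNReal.ofReal_of_nonpos (by linarith [Real.log_nonneg h1])]
      exact zero_le
    · obtain ⟨n, hn, hn'⟩ := exists_nat_pow_near_of_lt_one h h1.le
        (y := (2⁻¹ : ℝ)) (by norm_num) (by norm_num)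
      calc ENNReal.ofReal (-Real.log (dist x y))
          ≤ ENNReal.ofReal ((n + 1 : ℕ) * Real.log 2) := by
            refine ENNReal.ofReal_le_ofReal ?_
            have := Real.log_lt_log (by positivity) hn
            rw [Real.log_pow, Real.log_inv] at this
            linarith
        _ = ∑ _k ∈ Finset.range (n + 1), ENNReal.ofReal (Real.log 2) := by
            rw [Finset.sum_const, Finset.card_range, nsmul_eq_mul,
              ENNReal.ofReal_mul (Nat.cast_nonneg _), ENNReal.ofReal_natCast]
        _ = ∑ k ∈ Finset.range (n + 1), (Metric.closedBall x ((2⁻¹ : ℝ) ^ k)).indicator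
              (fun _ => ENNReal.ofReal (Real.log 2)) y := by
            refine Finset.sum_congr rfl fun k hk => ?_
            rw [indicator_of_mem]
            rw [Metric.mem_closedBall']
            exact hn'.trans (pow_le_pow_of_le_one (by norm_num) (by norm_num)
              (Nat.lt_succ_iff.1 (Finset.mem_range.1 hk)))
        _ ≤ _ := ENNReal.sum_le_tsum _

lemma logEnergy_le_tsum (μ : Measure (RSpace 2)) [IsFiniteMeasure μ] :
    logEnergy μ ≤ ENNReal.ofReal (Real.log 2) * ∑' k : ℕ, pairMass μ ((2⁻¹ : ℝ) ^ k) := by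
  calc logEnergy μ
      ≤ ∫⁻ x, ∫⁻ y, ∑' k : ℕ, (Metric.closedBall x ((2⁻¹ : ℝ) ^ k)).indicator
        (fun _ => ENNReal.ofReal (Real.log 2)) y ∂μ ∂μ :=
        lintegral_mono fun x => lintegral_mono fun y => toENNReal_neg_log_edist_le x y
    _ = ∫⁻ x, ∑' k : ℕ, ENNReal.ofReal (Real.log 2) *
          μ (Metric.closedBall x ((2⁻¹ : ℝ) ^ k)) ∂μ := by
        refine lintegral_congr fun x => ?_
        rw [lintegral_tsum fun k =>
          (measurable_const.indicator Metric.isClosed_closedBall.measurableSet).aemeasurable]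
        refine tsum_congr fun k => ?_
        rw [lintegral_indicator_const Metric.isClosed_closedBall.measurableSet]
    _ = _ := by
        rw [lintegral_tsum fun k =>
          ((measurable_measure_closedBall μ _).const_mul _).aemeasurable, ← ENNReal.tsum_mul_left]
        refine tsum_congr fun k => ?_
        rw [lintegral_const_mul _ (measurable_measure_closedBall μ _)]
        rfl

lemma integrable_dyadicPotential (μ : Measure (RSpace 2)) [IsFiniteMeasure μ] (n : ℕ) :
    Integrable (dyadicPotential μ n) μ := by
  refine Integrable.of_bound (C := n * μ.real univ)
    (contDiff_dyadicPotential μ n).continuous.aestronglyMeasurable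
    (Eventually.of_forall fun x => ?_)
  rw [Real.norm_of_nonneg (dyadicPotential_nonneg _ _ _)]
  exact dyadicPotential_le _ _ _

lemma sum_measure_closedBall_le_dyadicPotential (μ : Measure (RSpace 2)) [IsFiniteMeasure μ]
    (n : ℕ) (x : RSpace 2) :
    ∑ k ∈ Finset.range n, μ (Metric.closedBall x ((2⁻¹ : ℝ) ^ k)) ≤
      ENNReal.ofReal (dyadicPotential μ n x) := by
  rw [dyadicPotential, ofReal_integral_eq_lintegral_ofReal (integrable_dyadicKernel μ n x)
    (Eventually.of_forall fun y => dyadicKernel_nonneg _ _)]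
  calc ∑ k ∈ Finset.range n, μ (Metric.closedBall x ((2⁻¹ : ℝ) ^ k))
      = ∫⁻ y, ∑ k ∈ Finset.range n, (Metric.closedBall x ((2⁻¹ : ℝ) ^ k)).indicator 1 y ∂μ := by
        rw [lintegral_finsetSum _ fun k _ =>
          measurable_one.indicator Metric.isClosed_closedBall.measurableSet]
        refine Finset.sum_congr rfl fun k _ => ?_
        rw [lintegral_indicator_one Metric.isClosed_closedBall.measurableSet]
    _ ≤ _ := by
        refine lintegral_mono fun y => ?_
        simp only [dyadicKernel]
        rw [ENNReal.ofReal_sum_of_nonneg fun k _ => unitBump.nonneg]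
        refine Finset.sum_le_sum fun k _ => ?_
        by_cases h : y ∈ Metric.closedBall x ((2⁻¹ : ℝ) ^ k)
        · rw [unitBump.one_of_mem_closedBall]
          · rw [indicator_of_mem h, Pi.one_apply, ENNReal.ofReal_one]
          · rw [Metric.mem_closedBall', dist_eq_norm, inv_pow, ← one_div,
              le_div_iff₀ (by positivity)] at h
            rw [mem_closedBall_zero_iff, norm_smul, norm_pow, Real.norm_ofNat, mul_comm]
            exact h
        · rw [indicator_of_notMem h]
          exact zero_le

lemma sum_pairMass_le_integral_dyadicPotential (μ : Measure (RSpace 2)) [IsFiniteMeasure μ]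
    (n : ℕ) : ∑ k ∈ Finset.range n, pairMass μ ((2⁻¹ : ℝ) ^ k) ≤
      ENNReal.ofReal (∫ x, dyadicPotential μ n x ∂μ) := by
  rw [ofReal_integral_eq_lintegral_ofReal (integrable_dyadicPotential μ n)
    (Eventually.of_forall fun y => dyadicPotential_nonneg _ _ _)]
  unfold pairMass
  rw [← lintegral_finsetSum _ fun k _ => measurable_measure_closedBall μ _]
  exact lintegral_mono fun x => sum_measure_closedBall_le_dyadicPotential μ n x

/-- The Dirichlet energy of the dyadic potential is controlled by its integral against `μ`. -/
lemma exists_integral_fderiv_dyadicPotential_le : ∃ K : ℝ≥0, ∀ (μ : Measure (RSpace 2))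
    [IsFiniteMeasure μ] (n : ℕ), ∫ x, ‖fderiv ℝ (dyadicPotential μ n) x‖ ^ 2 ≤
      K * (2 * μ.real univ ^ 2 + ∫ x, dyadicPotential μ n x ∂μ) := by
  obtain ⟨D, hD⟩ := exists_fderiv_dyadicPotential_le
  set V := volume (Metric.ball (0 : RSpace 2) 1)
  have hV : V ≠ ⊤ := measure_ball_lt_top.ne
  refine ⟨D ^ 2 * (32 * V.toNNReal), fun μ _ n => ?_⟩
  have hX : 0 ≤ ∫ x, dyadicPotential μ n x ∂μ :=
    integral_nonneg fun _ => dyadicPotential_nonneg _ _ _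
  have hc : Continuous (fderiv ℝ (dyadicPotential μ n)) :=
    (contDiff_dyadicPotential μ n).continuous_fderiv (by simp)
  have hc2 : Continuous fun x => ‖fderiv ℝ (dyadicPotential μ n) x‖ ^ 2 := hc.norm.pow 2
  rw [integral_eq_lintegral_of_nonneg_ae (Eventually.of_forall fun x => by positivity)
    hc2.aestronglyMeasurable]
  refine ENNReal.toReal_le_of_le_ofReal (by positivity) ?_
  have hmeas : Measurable fun x => (∑ k ∈ Finset.range n,
      (2 : ℝ≥0∞) ^ k * μ (Metric.closedBall x (2 * (2⁻¹ : ℝ) ^ k))) ^ 2 :=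
    (Finset.measurable_fun_sum _ fun k _ =>
      (measurable_measure_closedBall μ _).const_mul _).pow_const 2
  calc ∫⁻ x, ENNReal.ofReal (‖fderiv ℝ (dyadicPotential μ n) x‖ ^ 2)
      ≤ ∫⁻ x, (D : ℝ≥0∞) ^ 2 * (∑ k ∈ Finset.range n,
          2 ^ k * μ (Metric.closedBall x (2 * (2⁻¹ : ℝ) ^ k))) ^ 2 := by
        refine lintegral_mono fun x => ?_
        rw [ENNReal.ofReal_pow (norm_nonneg _), ofReal_norm, ← mul_pow, Finset.mul_sum]
        gcongr
        simpa only [mul_assoc] using hD μ n x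
    _ = (D : ℝ≥0∞) ^ 2 * ∫⁻ x, (∑ k ∈ Finset.range n,
          2 ^ k * μ (Metric.closedBall x (2 * (2⁻¹ : ℝ) ^ k))) ^ 2 :=
        lintegral_const_mul _ hmeas
    _ ≤ (D : ℝ≥0∞) ^ 2 * (32 * V *
          (2 * μ univ ^ 2 + ENNReal.ofReal (∫ x, dyadicPotential μ n x ∂μ))) := by
        gcongr
        refine (lintegral_sq_sum_measure_closedBall_le μ n).trans ?_
        gcongr
        exact sum_pairMass_le_integral_dyadicPotential μ n
    _ = _ := by
        rw [ENNReal.ofReal_mul (by positivity), ENNReal.ofReal_add (by positivity) hX,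
          ENNReal.ofReal_mul zero_le_two, ENNReal.ofReal_pow measureReal_nonneg,
          ofReal_measureReal, ENNReal.ofReal_coe_nnreal, ENNReal.ofReal_ofNat]
        push_cast
        rw [ENNReal.coe_toNNReal hV, mul_assoc ((D : ℝ≥0∞) ^ 2)]

/-- If the pairing of a compactly supported measure `μ` with test functions is bounded by their
Dirichlet norms, then the mass and the logarithmic energy of `μ` are bounded. -/
theorem exists_measure_univ_le_and_logEnergy_le {R : ℝ} (hR : 0 < R) (M : ℝ≥0) :
    ∃ C : ℝ≥0, ∀ (μ : Measure (RSpace 2)) [IsFiniteMeasure μ],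
      μ (Metric.closedBall 0 R)ᶜ = 0 →
      (∀ φ : RSpace 2 → ℝ, ContDiff ℝ ∞ φ → HasCompactSupport φ →
        tsupport φ ⊆ Metric.closedBall 0 (R + 2) →
        ∫ x, φ x ∂μ ≤ M * Real.sqrt (∫ x, ‖fderiv ℝ φ x‖ ^ 2)) →
      μ univ ≤ C ∧ logEnergy μ ≤ C := by
  obtain ⟨K, hK⟩ := exists_integral_fderiv_dyadicPotential_le
  set χ : ContDiffBump (0 : RSpace 2) := ⟨R, R + 1, hR, by linarith⟩
  -- Testing with a cutoff equal to `1` on the carrier of `μ` bounds the mass by `A`.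
  set A : ℝ := M * Real.sqrt (∫ x, ‖fderiv ℝ χ x‖ ^ 2)
  have hA : 0 ≤ A := by positivity
  refine ⟨A.toNNReal + (Real.log 2 * (2 * M ^ 2 * K + 2 * A ^ 2)).toNNReal,
    fun μ _ hμ h => ?_⟩
  have hmass : μ.real univ ≤ A := by
    refine le_trans ?_ (h χ χ.contDiff χ.hasCompactSupport ?_)
    · refine le_of_eq ?_
      have : ∀ᵐ y ∂μ, y ∈ Metric.closedBall (0 : RSpace 2) R := by
        rw [ae_iff]; exact hμ
      rw [integral_congr_ae (g := fun _ => (1 : ℝ))]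
      · simp
      · filter_upwards [this] with y hy
        exact χ.one_of_mem_closedBall hy
    · rw [χ.tsupport_eq]
      exact Metric.closedBall_subset_closedBall (show R + 1 ≤ R + 2 by linarith)
  have hX : ∀ n, ∫ x, dyadicPotential μ n x ∂μ ≤ 2 * M ^ 2 * K + 2 * A ^ 2 := by
    intro n
    have hX0 : 0 ≤ ∫ x, dyadicPotential μ n x ∂μ :=
      integral_nonneg fun _ => dyadicPotential_nonneg _ _ _
    have hts := tsupport_dyadicPotential_subset hμ n
    have h1 := h _ (contDiff_dyadicPotential μ n)
      ((isCompact_closedBall _ _).of_isClosed_subset (isClosed_tsupport _) hts) hts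
    have h2 := hK μ n
    set X := ∫ x, dyadicPotential μ n x ∂μ
    set I := ∫ x, ‖fderiv ℝ (dyadicPotential μ n) x‖ ^ 2
    have hI : 0 ≤ I := integral_nonneg fun _ => by positivity
    have h3 : X ^ 2 ≤ M ^ 2 * I := by
      calc X ^ 2 ≤ (M * Real.sqrt I) ^ 2 := by gcongr
        _ = M ^ 2 * I := by rw [mul_pow, Real.sq_sqrt hI]
    have h4 : μ.real univ ^ 2 ≤ A ^ 2 := by gcongr
    have h5 : X ^ 2 ≤ M ^ 2 * K * (2 * A ^ 2 + X) := by
      calc X ^ 2 ≤ M ^ 2 * I := h3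
        _ ≤ M ^ 2 * (K * (2 * A ^ 2 + X)) := by
          gcongr
          exact h2.trans (by gcongr)
        _ = _ := by ring
    have hMK : (0 : ℝ) ≤ M ^ 2 * K := by positivity
    -- With `B = M² K`, the inequality `X² ≤ B (2A² + X)` fails once `X > 2B + 2A²`.
    by_contra! hlt
    nlinarith [sq_nonneg A]
  refine ⟨?_, ?_⟩
  · rw [← ofReal_measureReal]
    refine (ENNReal.ofReal_le_ofReal hmass).trans ?_
    push_cast
    exact le_self_add
  · refine (logEnergy_le_tsum μ).trans ?_
    calc ENNReal.ofReal (Real.log 2) * ∑' k : ℕ, pairMass μ ((2⁻¹ : ℝ) ^ k)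
        ≤ ENNReal.ofReal (Real.log 2) * ENNReal.ofReal (2 * M ^ 2 * K + 2 * A ^ 2) := by
          gcongr
          refine ENNReal.tsum_le_of_sum_range_le fun n => ?_
          exact (sum_pairMass_le_integral_dyadicPotential μ n).trans
            (ENNReal.ofReal_le_ofReal (hX n))
      _ = ENNReal.ofReal (Real.log 2 * (2 * M ^ 2 * K + 2 * A ^ 2)) :=
          (ENNReal.ofReal_mul (Real.log_nonneg one_le_two)).symm
      _ ≤ _ := by
          push_cast
          exact le_add_self

/-! ### The local energy bound at every time -/

lemma abs_integral_inner_le_of_lintegral_sq_le {N : ℕ} {R : ℝ} {M : ℝ≥0}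
    {v Φ : RSpace N → RSpace N} (hv : LocallyIntegrable v volume)
    (hM : ∫⁻ x in Metric.closedBall 0 R, ‖v x‖ₑ ^ 2 ≤ M)
    (hΦ : Continuous Φ) (hsupp : tsupport Φ ⊆ Metric.closedBall 0 R) :
    |∫ x, inner ℝ (Φ x) (v x)| ≤ Real.sqrt M * Real.sqrt (∫ x, ‖Φ x‖ ^ 2) := by
  set B := Metric.closedBall (0 : RSpace N) R
  have hΦc : HasCompactSupport Φ :=
    (isCompact_closedBall _ _).of_isClosed_subset (isClosed_tsupport _) hsupp
  have hΦ2 : Continuous fun x => ‖Φ x‖ ^ 2 := hΦ.norm.pow 2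
  have hint : Integrable fun x => ‖Φ x‖ ^ 2 :=
    hΦ2.integrable_of_hasCompactSupport (hΦc.mono' fun x hx => by
      refine subset_tsupport _ fun h => hx ?_
      simp [h])
  have hsq : ∫⁻ x in B, ‖Φ x‖ₑ ^ 2 ≤ ENNReal.ofReal (∫ x, ‖Φ x‖ ^ 2) := by
    rw [ofReal_integral_eq_lintegral_ofReal hint (Eventually.of_forall fun x => by positivity)]
    refine (setLIntegral_le_lintegral _ _).trans_eq (lintegral_congr fun x => ?_)
    rw [ENNReal.ofReal_pow (norm_nonneg _), ofReal_norm]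
  have key : ‖∫ x, inner ℝ (Φ x) (v x)‖ₑ ≤
      ENNReal.ofReal (Real.sqrt M * Real.sqrt (∫ x, ‖Φ x‖ ^ 2)) := by
    have hset : ∫ x, inner ℝ (Φ x) (v x) = ∫ x in B, inner ℝ (Φ x) (v x) := by
      refine (setIntegral_eq_integral_of_forall_compl_eq_zero fun x hx => ?_).symm
      rw [image_eq_zero_of_notMem_tsupport fun h => hx (hsupp h), inner_zero_left]
    rw [hset]
    calc ‖∫ x in B, inner ℝ (Φ x) (v x)‖ₑ
        ≤ ∫⁻ x in B, ‖(inner ℝ (Φ x) (v x) : ℝ)‖ₑ := enorm_integral_le_lintegral_enorm _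
      _ ≤ ∫⁻ x in B, ((fun x => ‖Φ x‖ₑ) * fun x => ‖v x‖ₑ) x := by
          refine lintegral_mono fun x => ?_
          rw [Pi.mul_apply, ← ofReal_norm, ← ofReal_norm, ← ofReal_norm,
            ← ENNReal.ofReal_mul (norm_nonneg _)]
          exact ENNReal.ofReal_le_ofReal (norm_inner_le_norm _ _)
      _ ≤ (∫⁻ x in B, ‖Φ x‖ₑ ^ (2 : ℝ)) ^ (1 / 2 : ℝ) *
            (∫⁻ x in B, ‖v x‖ₑ ^ (2 : ℝ)) ^ (1 / 2 : ℝ) :=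
          ENNReal.lintegral_mul_le_Lp_mul_Lq _ Real.HolderConjugate.two_two
            hΦ.enorm.aemeasurable hv.aestronglyMeasurable.enorm.restrict
      _ ≤ ENNReal.ofReal (∫ x, ‖Φ x‖ ^ 2) ^ (1 / 2 : ℝ) *
            ENNReal.ofReal M ^ (1 / 2 : ℝ) := by
          simp only [ENNReal.rpow_ofNat, ENNReal.ofReal_coe_nnreal]
          gcongr
      _ = _ := by
          rw [ENNReal.ofReal_rpow_of_nonneg (integral_nonneg fun _ => by positivity) (by norm_num),
            ENNReal.ofReal_rpow_of_nonneg M.coe_nonneg (by norm_num),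
            ← Real.sqrt_eq_rpow, ← Real.sqrt_eq_rpow, mul_comm (Real.sqrt M),
            ENNReal.ofReal_mul (Real.sqrt_nonneg _)]
  rwa [← ofReal_norm, ENNReal.ofReal_le_ofReal_iff (by positivity), Real.norm_eq_abs] at key

lemma exists_mem_Icc_abs_sub_lt_of_ae {T : ℝ} (hT : 0 < T) {p : ℝ → Prop}
    (hp : ∀ᵐ t ∂(volume.restrict (Icc 0 T)), p t) {t : ℝ} (ht : t ∈ Icc 0 T) {δ : ℝ}
    (hδ : 0 < δ) : ∃ s ∈ Icc 0 T, |t - s| < δ ∧ p s := by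
  by_contra! hcon
  have hlt : max 0 (t - δ) < min T (t + δ) := by
    rw [max_lt_iff, lt_min_iff, lt_min_iff]
    obtain ⟨h0, h1⟩ := ht
    exact ⟨⟨hT, by linarith⟩, by linarith, by linarith⟩
  rw [ae_restrict_iff' measurableSet_Icc, ae_iff] at hp
  have hzero : volume (Ioo (max 0 (t - δ)) (min T (t + δ))) = 0 := by
    refine measure_mono_null ?_ hp
    intro s hs hps
    obtain ⟨h1, h2⟩ := hs
    rw [max_lt_iff] at h1
    rw [lt_min_iff] at h2
    have hs : s ∈ Icc 0 T := ⟨h1.1.le, h2.1.le⟩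
    exact hcon s hs (abs_lt.2 ⟨by linarith, by linarith⟩) (hps hs)
  rw [Real.volume_Ioo, ENNReal.ofReal_eq_zero] at hzero
  linarith

/-- The local energy bound, in its dual form, holds at every time. -/
theorem IsApproximateEulerFamily.exists_abs_integral_inner_le {N : ℕ} {T : ℝ} (hT : 0 < T)
    {S : Set ℝ} {u : ℝ → ℝ → RSpace N → RSpace N} (hu : IsApproximateEulerFamily T S u) (R : ℝ) :
    ∃ M : ℝ≥0, ∀ ε ∈ S, ∀ t ∈ Icc 0 T, ∀ Φ : RSpace N → RSpace N, ContDiff ℝ ∞ Φ →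
      tsupport Φ ⊆ Metric.closedBall 0 R →
      |∫ x, inner ℝ (Φ x) (u ε t x)| ≤ M * Real.sqrt (∫ x, ‖Φ x‖ ^ 2) := by
  obtain ⟨M, hM⟩ := hu.energy_bound R
  obtain ⟨L, hL⟩ := hu.lip_bound
  obtain ⟨K, hK⟩ := hL R
  refine ⟨NNReal.sqrt M, fun ε hε t ht Φ hΦ hsupp => ?_⟩
  have hΦc : HasCompactSupport Φ :=
    (isCompact_closedBall _ _).of_isClosed_subset (isClosed_tsupport _) hsupp
  rw [Real.coe_sqrt]
  refine le_of_forall_pos_le_add fun η hη => ?_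
  have hK0 : 0 ≤ K * sobolevNorm L Φ := mul_nonneg K.coe_nonneg (Real.sqrt_nonneg _)
  -- A nearby time `s` with the `L²` bound, so close that the Lipschitz estimate costs at most `η`;
  -- the `+ 1` keeps the denominator positive.
  obtain ⟨s, hs, hts, hMs⟩ := exists_mem_Icc_abs_sub_lt_of_ae hT (hM ε hε) ht
    (δ := η / (K * sobolevNorm L Φ + 1)) (by positivity)
  have hint : ∀ r ∈ Icc 0 T, Integrable fun x => (inner ℝ (Φ x) (u ε r x) : ℝ) := by
    intro r hr
    have hloc := hu.locallyIntegrable ε hε r hr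
    obtain ⟨D, hD⟩ := hΦc.exists_bound_of_continuous hΦ.continuous
    have hon : IntegrableOn (fun x => (inner ℝ (Φ x) (u ε r x) : ℝ)) (tsupport Φ) := by
      refine Integrable.mono' ((hloc.integrableOn_isCompact hΦc).norm.const_mul D)
        (hΦ.continuous.aestronglyMeasurable.inner hloc.aestronglyMeasurable.restrict) ?_
      refine Eventually.of_forall fun x => (norm_inner_le_norm _ _).trans ?_
      gcongr
      exact hD x
    refine (integrableOn_iff_integrable_of_support_subset fun x hx => ?_).1 hon
    refine subset_tsupport _ fun h => hx ?_
    simp [h]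
  have hsplit : ∫ x, inner ℝ (Φ x) (u ε t x) =
      (∫ x, inner ℝ (Φ x) (u ε s x)) + ∫ x, inner ℝ (Φ x) (u ε t x - u ε s x) := by
    simp only [inner_sub_right]
    rw [integral_sub (hint t ht) (hint s hs)]
    ring
  have h1 := abs_integral_inner_le_of_lintegral_sq_le (hu.locallyIntegrable ε hε s hs) hMs
    hΦ.continuous hsupp
  have h2 := hK ε hε s hs t ht Φ hΦ hΦc hsupp
  have h3 : K * |t - s| * sobolevNorm L Φ ≤ η := by
    rw [lt_div_iff₀ (by positivity)] at hts
    nlinarith [abs_nonneg (t - s)]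
  rw [hsplit]
  exact (abs_add_le _ _).trans (add_le_add h1 (h2.trans h3))

/-! ### From velocity to vorticity -/

/-- The rotated gradient `(∂₂φ, -∂₁φ)`. -/
def rotatedGradient (φ : RSpace 2 → ℝ) (x : RSpace 2) : RSpace 2 :=
  !₂[fderiv ℝ φ x (EuclideanSpace.single 1 1), -fderiv ℝ φ x (EuclideanSpace.single 0 1)]

lemma contDiff_rotatedGradient {φ : RSpace 2 → ℝ} (hφ : ContDiff ℝ ∞ φ) :
    ContDiff ℝ ∞ (rotatedGradient φ) := by
  have h : ContDiff ℝ ∞ (fderiv ℝ φ) := hφ.fderiv_right (by simp)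
  rw [contDiff_euclidean]
  intro i
  fin_cases i
  · exact h.clm_apply contDiff_const
  · exact (h.clm_apply contDiff_const).neg

lemma tsupport_rotatedGradient_subset (φ : RSpace 2 → ℝ) :
    tsupport (rotatedGradient φ) ⊆ tsupport φ := by
  refine (closure_mono fun x hx => ?_).trans (tsupport_fderiv_subset ℝ)
  refine fun h => hx ?_
  ext i
  fin_cases i <;> simp [rotatedGradient, h]

/-- This is the integrand in `IsVorticity`: pairing `φ` with the vorticity is pairing its rotated
gradient with the velocity. -/
lemma inner_rotatedGradient (φ : RSpace 2 → ℝ) (x v : RSpace 2) :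
    inner ℝ (rotatedGradient φ x) v = v 0 * fderiv ℝ φ x (EuclideanSpace.single 1 1)
      - v 1 * fderiv ℝ φ x (EuclideanSpace.single 0 1) := by
  simp [rotatedGradient, PiLp.inner_apply, Fin.sum_univ_two]
  ring

lemma norm_rotatedGradient_sq_le (φ : RSpace 2 → ℝ) (x : RSpace 2) :
    ‖rotatedGradient φ x‖ ^ 2 ≤ 2 * ‖fderiv ℝ φ x‖ ^ 2 := by
  have h : ∀ i : Fin 2, fderiv ℝ φ x (EuclideanSpace.single i 1) ^ 2 ≤ ‖fderiv ℝ φ x‖ ^ 2 := by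
    intro i
    rw [sq_le_sq, abs_norm, ← Real.norm_eq_abs]
    simpa using (fderiv ℝ φ x).le_opNorm (EuclideanSpace.single i 1)
  rw [EuclideanSpace.real_norm_sq_eq]
  simp only [rotatedGradient, Fin.sum_univ_two]
  simp
  linarith [h 0, h 1]

lemma negPart_toJordanDecomposition_of_nonneg {α : Type*} [MeasurableSpace α] {s : SignedMeasure α}
    (hs : 0 ≤ s) : s.toJordanDecomposition.negPart = 0 := by
  have hs' : 0 ≤[univ] s := by rwa [VectorMeasure.le_restrict_univ_iff_le]
  have hfin := SignedMeasure.toMeasureOfZeroLE_finite (s := s) hs' MeasurableSet.univ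
  let j : JordanDecomposition α :=
    ⟨s.toMeasureOfZeroLE univ MeasurableSet.univ hs', 0,
      Measure.MutuallySingular.zero_right⟩
  have hj : s = j.toSignedMeasure := by
    rw [JordanDecomposition.toSignedMeasure, Measure.toSignedMeasure_zero, sub_zero,
      SignedMeasure.toMeasureOfZeroLE_toSignedMeasure]
  rw [SignedMeasure.toJordanDecomposition_eq hj]

/-- One-signedness enters here: one Jordan part vanishes, so nothing cancels and the duality bound
passes to the total variation. -/
lemma abs_signedIntegral_eq {N : ℕ} {σ : SignedMeasure (RSpace N)} (hσ : 0 ≤ σ ∨ σ ≤ 0)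
    (φ : RSpace N → ℝ) : |signedIntegral σ φ| = |∫ x, φ x ∂σ.totalVariation| := by
  rcases hσ with h | h
  · have := negPart_toJordanDecomposition_of_nonneg h
    simp [signedIntegral, SignedMeasure.totalVariation, this]
  · have := negPart_toJordanDecomposition_of_nonneg (neg_nonneg.2 h)
    rw [SignedMeasure.toJordanDecomposition_neg, JordanDecomposition.neg_negPart] at this
    simp [signedIntegral, SignedMeasure.totalVariation, this]

/-- One-signed vorticities carried by a fixed ball have uniformly bounded mass and logarithmic
energy. -/
theorem exists_totalVariation_le_and_logEnergy_le {T : ℝ} (hT : 0 < T) {S : Set ℝ}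
    {u : ℝ → ℝ → RSpace 2 → RSpace 2} (hu : IsApproximateEulerFamily T S u) (R : ℝ) :
    ∃ C : ℝ≥0, ∀ ε ∈ S, ∀ t ∈ Icc 0 T, ∀ σ : SignedMeasure (RSpace 2),
      IsVorticity (u ε t) σ → (0 ≤ σ ∨ σ ≤ 0) → SupportedInBall R σ →
      σ.totalVariation univ ≤ C ∧ logEnergy σ.totalVariation ≤ C := by
  -- The duality theorem needs a positive radius.
  set R' := max R 1
  obtain ⟨M, hM⟩ := hu.exists_abs_integral_inner_le hT (R' + 2)
  obtain ⟨C, hC⟩ := exists_measure_univ_le_and_logEnergy_le (R := R')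
    (one_pos.trans_le (le_max_right _ _)) (M * NNReal.sqrt 2)
  refine ⟨C, fun ε hε t ht σ hσ hsign hsupp => ?_⟩
  have : IsFiniteMeasure σ.totalVariation := by
    unfold SignedMeasure.totalVariation; infer_instance
  refine hC _ (measure_mono_null ?_ hsupp) fun φ hφ hφc hφs => ?_
  · exact compl_subset_compl.2 (Metric.closedBall_subset_closedBall (le_max_left _ _))
  · have h := hM ε hε t ht _ (contDiff_rotatedGradient hφ)
      ((tsupport_rotatedGradient_subset φ).trans hφs)
    simp only [inner_rotatedGradient] at h
    rw [← hσ φ hφ hφc, abs_signedIntegral_eq hsign] at h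
    refine (le_abs_self _).trans (h.trans ?_)
    rw [NNReal.coe_mul, Real.coe_sqrt, mul_assoc, ← Real.sqrt_mul (by positivity),
      NNReal.coe_ofNat, ← integral_const_mul]
    refine mul_le_mul_of_nonneg_left (Real.sqrt_le_sqrt ?_) M.coe_nonneg
    have hc : Continuous fun x => 2 * ‖fderiv ℝ φ x‖ ^ 2 :=
      continuous_const.mul ((hφ.continuous_fderiv (by simp)).norm.pow 2)
    have hint : Integrable fun x => 2 * ‖fderiv ℝ φ x‖ ^ 2 := by
      refine hc.integrable_of_hasCompactSupport ?_
      refine (hφc.fderiv ℝ).mono' fun x hx => subset_tsupport _ fun h => hx ?_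
      simp [h]
    exact integral_mono_of_nonneg (Eventually.of_forall fun x => by positivity) hint
      (Eventually.of_forall fun x => norm_rotatedGradient_sq_le φ x)

/-! ### From logarithmic energy to the packing norm -/

/-- The kernel is at least `-log (2r)` on pairs from the ball, and `2r < 1` because `R₀ < 1/2`. The
prefactor is the largest ratio `log r / log (2r)` for `r ≤ R₀`. -/
lemma ofReal_abs_log_mul_sq_le_lintegral (μ : Measure (RSpace 2)) {R₀ r : ℝ}
    (hR₀' : R₀ < 1 / 2) (hr : 0 < r) (hr' : r ≤ R₀) (c : RSpace 2) :
    ENNReal.ofReal |Real.log r| * μ (Metric.ball c r) ^ 2 ≤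
      ENNReal.ofReal (Real.log R₀ / Real.log (2 * R₀)) *
        ∫⁻ x in Metric.ball c r, ∫⁻ y, (-ENNReal.log (edist x y)).toENNReal ∂μ ∂μ := by
  have hR₀ : 0 < R₀ := hr.trans_le hr'
  have hlogR : Real.log (2 * R₀) < 0 := Real.log_neg (by linarith) (by linarith)
  have hlogr : Real.log (2 * r) < 0 := Real.log_neg (by linarith) (by linarith)
  have hlogr' : Real.log r < 0 := Real.log_neg hr (by linarith)
  have hlogR' : Real.log R₀ < 0 := Real.log_neg hR₀ (by linarith)
  have hlog2 : 0 < Real.log 2 := Real.log_pos one_lt_two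
  have hle : Real.log r ≤ Real.log R₀ := Real.log_le_log hr hr'
  have hratio : |Real.log r| ≤ Real.log R₀ / Real.log (2 * R₀) * -Real.log (2 * r) := by
    rw [abs_of_neg hlogr', ← neg_div_neg_eq, div_mul_eq_mul_div, le_div_iff₀ (by linarith)]
    -- After cross-multiplication only `log 2 * (log R₀ - log r) ≥ 0` is left.
    rw [Real.log_mul two_ne_zero hR₀.ne', Real.log_mul two_ne_zero hr.ne']
    nlinarith
  have hinner : ∀ x ∈ Metric.ball c r,
      ENNReal.ofReal (-Real.log (2 * r)) * μ (Metric.ball c r) ≤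
        ∫⁻ y, (-ENNReal.log (edist x y)).toENNReal ∂μ := by
    intro x hx
    rw [← setLIntegral_const]
    refine (setLIntegral_mono' measurableSet_ball fun y hy => ?_).trans
      (setLIntegral_le_lintegral _ _)
    have hd : edist x y ≤ ENNReal.ofReal (2 * r) := by
      rw [edist_dist]
      refine ENNReal.ofReal_le_ofReal ?_
      linarith [dist_triangle_right x y c, Metric.mem_ball.1 hx, Metric.mem_ball.1 hy]
    have h1 := EReal.toENNReal_le_toENNReal (EReal.neg_le_neg_iff.2 (ENNReal.log_le_log hd))
    rwa [ENNReal.log_ofReal_of_pos (by linarith), ← EReal.coe_neg,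
      EReal.toENNReal_of_ne_top (EReal.coe_ne_top _), EReal.toReal_coe] at h1
  calc ENNReal.ofReal |Real.log r| * μ (Metric.ball c r) ^ 2
      ≤ ENNReal.ofReal (Real.log R₀ / Real.log (2 * R₀) * -Real.log (2 * r)) *
          μ (Metric.ball c r) ^ 2 := by gcongr
    _ = ENNReal.ofReal (Real.log R₀ / Real.log (2 * R₀)) *
          ∫⁻ _x in Metric.ball c r,
            ENNReal.ofReal (-Real.log (2 * r)) * μ (Metric.ball c r) ∂μ := by
        rw [setLIntegral_const, ENNReal.ofReal_mul (div_nonneg_of_nonpos hlogR'.le hlogR.le)]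
        ring
    _ ≤ _ := by
        exact mul_le_mul_right (setLIntegral_mono' measurableSet_ball hinner) _

lemma logVNorm_le {R₀ : ℝ} (hR₀' : R₀ < 1 / 2) (σ : SignedMeasure (RSpace 2)) :
    logVNorm univ R₀ σ ≤
      (ENNReal.ofReal (Real.log R₀ / Real.log (2 * R₀)) *
        logEnergy σ.totalVariation) ^ (1 / 2 : ℝ) := by
  unfold logVNorm
  refine ENNReal.rpow_le_rpow (iSup₂_le fun 𝓑 h𝓑 => ?_) (by norm_num)
  rw [ENNReal.tsum_eq_iSup_sum]
  refine iSup_le fun F => ?_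
  have hdisj : Set.PairwiseDisjoint (F : Set 𝓑) fun b => Metric.ball b.1.1 b.1.2 :=
    fun a _ b _ hab => h𝓑.2 a.2 b.2 fun h => hab (Subtype.ext h)
  refine (Finset.sum_le_sum fun (b : 𝓑) _ => ofReal_abs_log_mul_sq_le_lintegral σ.totalVariation hR₀'
    (h𝓑.1 b.1 b.2).1 (h𝓑.1 b.1 b.2).2.1 b.1.1).trans ?_
  rw [← Finset.mul_sum, ← lintegral_biUnion_finset hdisj fun b _ => measurableSet_ball]
  gcongr
  exact setLIntegral_le_lintegral _ _

/-! ### Propagation through pseudo-energy and moments -/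

/-- The part of the pseudo-energy due to the pairs of points at distance greater than `1`. -/
def farEnergy (μ : Measure (RSpace 2)) : ℝ≥0∞ :=
  ∫⁻ x, ∫⁻ y, (ENNReal.log (edist x y)).toENNReal ∂μ ∂μ

lemma toENNReal_log_edist_le (x y : RSpace 2) :
    (ENNReal.log (edist x y)).toENNReal ≤ 2 * (‖x‖ₑ ^ 2 + ‖y‖ₑ ^ 2) := by
  rcases eq_or_lt_of_le (dist_nonneg (x := x) (y := y)) with h | h
  · simp [edist_dist, ← h]
  · rw [edist_dist, ENNReal.log_ofReal_of_pos h,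
      EReal.toENNReal_of_ne_top (EReal.coe_ne_top _), EReal.toReal_coe, ← ofReal_norm,
      ← ofReal_norm, ← ENNReal.ofReal_pow (norm_nonneg _), ← ENNReal.ofReal_pow (norm_nonneg _),
      ← ENNReal.ofReal_add (by positivity) (by positivity)]
    suffices hle : Real.log (dist x y) ≤ 2 * (‖x‖ ^ 2 + ‖y‖ ^ 2) by
      refine (ENNReal.ofReal_le_ofReal hle).trans_eq ?_
      rw [ENNReal.ofReal_mul zero_le_two, ENNReal.ofReal_ofNat]
    have h1 := Real.log_le_sub_one_of_pos h
    have h2 : dist x y ≤ ‖x‖ + ‖y‖ := dist_le_norm_add_norm x y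
    nlinarith [sq_nonneg (‖x‖ - ‖y‖), sq_nonneg (‖x‖ + ‖y‖ - 1)]

lemma farEnergy_le (μ : Measure (RSpace 2)) :
    farEnergy μ ≤ 4 * (secondMoment μ * μ univ) := by
  have hm : Measurable fun x : RSpace 2 => ‖x‖ₑ ^ 2 := (measurable_enorm).pow_const 2
  calc farEnergy μ
      ≤ ∫⁻ x, ∫⁻ y, 2 * (‖x‖ₑ ^ 2 + ‖y‖ₑ ^ 2) ∂μ ∂μ :=
        lintegral_mono fun x => lintegral_mono fun y => toENNReal_log_edist_le x y
    _ = ∫⁻ x, 2 * (‖x‖ₑ ^ 2 * μ univ + secondMoment μ) ∂μ := by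
        refine lintegral_congr fun x => ?_
        rw [lintegral_const_mul _ (hm.const_add _), lintegral_add_left measurable_const,
          lintegral_const]
        rfl
    _ = 2 * (secondMoment μ * μ univ + secondMoment μ * μ univ) := by
        rw [lintegral_const_mul _ ((hm.mul_const _).add_const _),
          lintegral_add_left (hm.mul_const _), lintegral_mul_const _ hm, lintegral_const]
        rfl
    _ = _ := by ring

/-- Dropping the far part of `μ` only raises its pseudo-energy, so it needs no bound; finiteness of
the far part of `ν` rules out `∞ - ∞` and allows it to be moved across. -/
lemma logEnergy_le_of_pseudoEnergy_le {μ ν : Measure (RSpace 2)} {C : ℝ≥0}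
    (h : pseudoEnergy ν ≤ pseudoEnergy μ + ((C : ℝ) : EReal)) (hν : farEnergy ν ≠ ⊤) :
    logEnergy ν ≤ logEnergy μ + farEnergy ν + ENNReal.ofReal (2 * Real.pi * C) := by
  by_cases hμ : logEnergy μ = ⊤
  · simp [hμ]
  have hpi := Real.pi_pos
  have hc : (0 : ℝ) < 1 / (2 * Real.pi) := by positivity
  have hle : pseudoEnergy μ ≤ ((1 / (2 * Real.pi) : ℝ) : EReal) * (logEnergy μ : EReal) := by
    refine mul_le_mul_of_nonneg_left ?_ (EReal.coe_nonneg.2 hc.le)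
    refine (EReal.sub_le_sub le_rfl (EReal.coe_ennreal_nonneg _)).trans_eq ?_
    rw [sub_zero]; rfl
  have h' : ((1 / (2 * Real.pi) : ℝ) : EReal) * ((logEnergy ν : EReal) - (farEnergy ν : EReal)) ≤
      ((1 / (2 * Real.pi) : ℝ) : EReal) * (logEnergy μ : EReal) + ((C : ℝ) : EReal) :=
    h.trans (add_le_add_left hle _)
  generalize logEnergy ν = a at *
  generalize farEnergy ν = b at *
  generalize logEnergy μ = a₀ at *
  lift b to ℝ≥0 using hν
  lift a₀ to ℝ≥0 using hμ
  induction a using ENNReal.recTopCoe with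
  | top =>
    exfalso
    rw [EReal.coe_ennreal_top, EReal.coe_nnreal_eq_coe_real, EReal.coe_nnreal_eq_coe_real,
      EReal.top_sub_coe, EReal.coe_mul_top_of_pos hc, ← EReal.coe_mul, ← EReal.coe_add,
      top_le_iff] at h'
    exact EReal.coe_ne_top _ h'
  | coe a =>
    rw [EReal.coe_nnreal_eq_coe_real, EReal.coe_nnreal_eq_coe_real, EReal.coe_nnreal_eq_coe_real,
      ← EReal.coe_sub, ← EReal.coe_mul, ← EReal.coe_mul, ← EReal.coe_add, EReal.coe_le_coe_iff,
      one_div, inv_mul_le_iff₀ (by positivity), mul_add, mul_inv_cancel_left₀ (by positivity)] at h'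
    rw [← ENNReal.ofReal_coe_nnreal, ← ENNReal.ofReal_coe_nnreal, ← ENNReal.ofReal_coe_nnreal,
      ← ENNReal.ofReal_add (by positivity) (by positivity),
      ← ENNReal.ofReal_add (by positivity) (by positivity)]
    exact ENNReal.ofReal_le_ofReal (by linarith)

lemma secondMoment_le {μ : Measure (RSpace 2)} {R : ℝ}
    (hμ : μ (Metric.closedBall 0 R)ᶜ = 0) :
    secondMoment μ ≤ ENNReal.ofReal R ^ 2 * μ univ := by
  rw [secondMoment, ← lintegral_const]
  have : ∀ᵐ y ∂μ, y ∈ Metric.closedBall (0 : RSpace 2) R := by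
    rw [ae_iff]; exact hμ
  refine lintegral_mono_ae ?_
  filter_upwards [this] with y hy
  rw [← ofReal_norm]
  gcongr
  exact mem_closedBall_zero_iff.1 hy

end

/-! ### The uniform bound -/

theorem lemma4p1 (T : ℝ) (hT : 0 < T) (S : Set ℝ) (u : ℝ → ℝ → RSpace 2 → RSpace 2)
    (hu : IsApproximateEulerFamily T S u)
    (σ : ℝ → ℝ → SignedMeasure (RSpace 2))
    (hvort : ∀ ε ∈ S, ∀ t ∈ Set.Icc 0 T, IsVorticity (u ε t) (σ ε t))
    (hsign : (∀ ε ∈ S, ∀ t ∈ Set.Icc 0 T, 0 ≤ σ ε t) ∨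
      (∀ ε ∈ S, ∀ t ∈ Set.Icc 0 T, σ ε t ≤ 0))
    (hinit : ∃ R : ℝ, ∀ ε ∈ S, SupportedInBall R (σ ε 0))
    (hevol : (∃ R : ℝ, ∀ ε ∈ S, ∀ t ∈ Set.Icc 0 T, SupportedInBall R (σ ε t)) ∨
      (∃ C : ℝ≥0, ∀ ε ∈ S, ∀ t ∈ Set.Icc 0 T,
        InvariantsControlledBy C (σ ε 0).totalVariation (σ ε t).totalVariation))
    (R₀ : ℝ) (hR₀ : 0 < R₀) (hR₀' : R₀ < 1 / 2) :
    ∃ C : ℝ≥0, ∀ ε ∈ S, ∀ t ∈ Set.Icc 0 T, logVNorm Set.univ R₀ (σ ε t) ≤ C := by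
  have hsign' : ∀ ε ∈ S, ∀ t ∈ Icc 0 T, 0 ≤ σ ε t ∨ σ ε t ≤ 0 := fun ε hε t ht =>
    hsign.imp (fun h => h ε hε t ht) fun h => h ε hε t ht
  suffices hE : ∃ E : ℝ≥0∞, E ≠ ⊤ ∧ ∀ ε ∈ S, ∀ t ∈ Icc 0 T,
      logEnergy (σ ε t).totalVariation ≤ E by
    obtain ⟨E, hE, hle⟩ := hE
    have hfin : (ENNReal.ofReal (Real.log R₀ / Real.log (2 * R₀)) * E) ^ (1 / 2 : ℝ) ≠ ⊤ :=
      ENNReal.rpow_ne_top_of_nonneg (by norm_num) (ENNReal.mul_ne_top ENNReal.ofReal_ne_top hE)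
    refine ⟨ENNReal.toNNReal _, fun ε hε t ht =>
      ((logVNorm_le hR₀' _).trans ?_).trans_eq (ENNReal.coe_toNNReal hfin).symm⟩
    gcongr
    exact hle ε hε t ht
  rcases hevol with ⟨R, hR⟩ | ⟨C₁, hC₁⟩
  · obtain ⟨C, hC⟩ := exists_totalVariation_le_and_logEnergy_le hT hu R
    exact ⟨C, ENNReal.coe_ne_top, fun ε hε t ht =>
      (hC ε hε t ht _ (hvort ε hε t ht) (hsign' ε hε t ht) (hR ε hε t ht)).2⟩
  · obtain ⟨R, hR⟩ := hinit
    obtain ⟨C, hC⟩ := exists_totalVariation_le_and_logEnergy_le hT hu R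
    -- This bounds the far energy at all times: `farEnergy_le`, with `I₂` and `I₀` estimated by
    -- their initial bounds plus `C₁`.
    set F : ℝ≥0∞ := 4 * ((ENNReal.ofReal R ^ 2 * C + C₁) * (C + C₁))
    have hF : F ≠ ⊤ := by finiteness
    refine ⟨C + F + ENNReal.ofReal (2 * Real.pi * C₁), by finiteness, fun ε hε t ht => ?_⟩
    have h0 : (0 : ℝ) ∈ Icc 0 T := left_mem_Icc.2 hT.le
    obtain ⟨hm, hL⟩ := hC ε hε 0 h0 _ (hvort ε hε 0 h0) (hsign' ε hε 0 h0) (hR ε hε)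
    obtain ⟨hI₀, hI₂, hH⟩ := hC₁ ε hε t ht
    have hfar : farEnergy (σ ε t).totalVariation ≤ F := by
      refine (farEnergy_le _).trans (mul_le_mul_right (mul_le_mul' ?_ ?_) 4)
      · refine hI₂.trans ?_
        gcongr
        exact (secondMoment_le (hR ε hε)).trans (by gcongr)
      · exact hI₀.trans (by gcongr)
    refine (logEnergy_le_of_pseudoEnergy_le hH (ne_top_of_le_ne_top hF hfar)).trans ?_
    gcongr
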